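/- For every positive integer $n$ there is a simple closed curve in the Euclidean plane with exactly $n$ inscribed squares, where an inscribed square is a nondegenerate square all of whose four vertices lie on the curve (it need not be contained in the region bounded by the curve), and squares are counted as geometric figures, i.e. without regard to a labelling of their vertices. The curve can moreover be chosen infinitely differentiable (having a regular $C^\infty$ parametrization by the circle) and convex (being the boundary of a bounded convex open region). -/

import Mathlib

open scoped ContDiff

/-- `γ` is a parametrization (by `ℝ / 2πℤ`) of a simple closed curve in the Euclidean plane,
which is identified with `ℂ`. -/
structure IsSimpleClosedCurve (γ : ℝ → ℂ) : Prop where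
  continuous : Continuous γ
  periodic : Function.Periodic γ (2 * Real.pi)
  injOn : Set.InjOn γ (Set.Ico 0 (2 * Real.pi))

/-- The curve is infinitely differentiable: the parametrization is `C^∞` over `ℝ` and regular
(nowhere vanishing velocity), so that its image is a smooth curve without corners or cusps. -/
structure IsSmoothCurve (γ : ℝ → ℂ) : Prop where
  contDiff : ContDiff ℝ ∞ γ
  deriv_ne_zero : ∀ t, deriv γ t ≠ 0

/-- A set in the plane is a convex curve if it is the boundary of a (nonempty, bounded, open)
convex region. -/
def IsConvexCurve (C : Set ℂ) : Prop :=
  ∃ Ω : Set ℂ, Ω.Nonempty ∧ IsOpen Ω ∧ Bornology.IsBounded Ω ∧ Convex ℝ Ω ∧ frontier Ω = C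

/-- `S` is the set of the four vertices of a (nondegenerate) square. Multiplication by `I` is the
rotation by a right angle, so the vertices are listed in counterclockwise order. -/
def IsSquareVertexSet (S : Set ℂ) : Prop :=
  ∃ z v : ℂ, v ≠ 0 ∧
    S = {z, z + v, z + v + Complex.I * v, z + Complex.I * v}

/-- The squares inscribed in `C`, that is, with all four vertices on `C`. A square is identified
with its set of vertices. -/
def inscribedSquares (C : Set ℂ) : Set (Set ℂ) :=
  {S | IsSquareVertexSet S ∧ S ⊆ C}

/-! Take the curve `r = 1 / k θ` with `k = 1 + ε h`, where `h` is `π`-periodic and `ε` is small: it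
is smooth, strictly convex and symmetric about 0.

Let a square with vertices `c ± p`, `c ± I * p` be inscribed. By symmetry the chords with midpoints
`p` and `I * p` and half-vector `c` also join points of the curve. If `c ≠ 0`, strict convexity
allows only one chord of given direction and length, up to sign (`eq_or_eq_neg_of_parallel_chords`),
so `I * p = ± p`, which is absurd. Hence `c = 0` (`square_center_eq_zero`).

A centred square is inscribed iff `k` equals `1 / ‖p‖` at both `p.arg` and `p.arg + π / 2`. As `h =
squareProfile n` changes sign under this shift, `h` must vanish there and `‖p‖ = 1`. The zeros of
`h` are the arguments of the `4 * n`-th roots of unity, which fall into `n` squares, the fibres of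
`x ↦ x ^ 4` over the `n`-th roots of unity. -/

/-! ### Polar curves and their norms -/

/-- A positive smooth `π`-periodic function `k` whose radial curve `exp (i t) / k t` lies strictly
on one side of each of its tangent lines. -/
structure IsPolarGauge (k : ℝ → ℝ) : Prop where
  contDiff : ContDiff ℝ ∞ k
  periodic : Function.Periodic k Real.pi
  pos : ∀ t, 0 < k t
  support : ∀ t u, |u| ≤ Real.pi → u ≠ 0 →
    k t * Real.cos u + deriv k t * Real.sin u < k (t + u)

/-- The curve with polar equation `r = 1 / k θ`. -/
noncomputable def polarCurve (k : ℝ → ℝ) (t : ℝ) : ℂ :=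
  Complex.exp (t * Complex.I) / (k t : ℂ)

/-- The function, homogeneous of degree one, whose unit sphere is the curve `r = 1 / k θ`. -/
noncomputable def polarNorm (k : ℝ → ℝ) (z : ℂ) : ℝ :=
  ‖z‖ * k z.arg

/-- The linear functional that equals `1` on the tangent line of `r = 1 / k θ` at `θ = t`. -/
noncomputable def polarTangent (k : ℝ → ℝ) (t : ℝ) (z : ℂ) : ℝ :=
  k t * (z * Complex.exp (-(t * Complex.I))).re +
    deriv k t * (z * Complex.exp (-(t * Complex.I))).im

theorem polarTangent_add (k : ℝ → ℝ) (t : ℝ) (z w : ℂ) :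
    polarTangent k t (z + w) = polarTangent k t z + polarTangent k t w := by
  simp only [polarTangent, add_mul, Complex.add_re, Complex.add_im]
  ring

theorem polarTangent_real_mul (k : ℝ → ℝ) (t a : ℝ) (z : ℂ) :
    polarTangent k t (a * z) = a * polarTangent k t z := by
  simp only [polarTangent, mul_assoc, Complex.re_ofReal_mul, Complex.im_ofReal_mul]
  ring

theorem polarTangent_arg (k : ℝ → ℝ) (z : ℂ) :
    polarTangent k z.arg z = polarNorm k z := by
  have h : z * Complex.exp (-(z.arg * Complex.I)) = ‖z‖ := by
    nth_rw 1 [← Complex.norm_mul_exp_arg_mul_I z]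
    rw [mul_assoc, ← Complex.exp_add, add_neg_cancel, Complex.exp_zero, mul_one]
  rw [polarTangent, h, polarNorm]
  simp [mul_comm]

namespace IsPolarGauge

variable {k : ℝ → ℝ}

theorem periodic_two_pi (hk : IsPolarGauge k) : Function.Periodic k (2 * Real.pi) :=
  hk.periodic.nat_mul 2

theorem apply_eq_of_exp_eq (hk : IsPolarGauge k) {s t : ℝ}
    (h : Complex.exp (s * Complex.I) = Complex.exp (t * Complex.I)) : k s = k t := by
  obtain ⟨m, hm⟩ := Complex.exp_eq_exp_iff_exists_int.1 h
  have h1 : s = t + m * (2 * Real.pi) := by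
    have := congrArg Complex.im hm
    simpa using this
  rw [h1]
  exact hk.periodic_two_pi.int_mul m t

theorem polarNorm_polar (hk : IsPolarGauge k) {r : ℝ} (hr : 0 ≤ r) (t : ℝ) :
    polarNorm k (r * Complex.exp (t * Complex.I)) = r * k t := by
  rcases hr.eq_or_lt with rfl | hr
  · simp [polarNorm]
  have hn : ‖(r : ℂ) * Complex.exp (t * Complex.I)‖ = r := by
    rw [norm_mul, Complex.norm_exp_ofReal_mul_I, Complex.norm_of_nonneg hr.le, mul_one]
  have h := Complex.norm_mul_exp_arg_mul_I ((r : ℂ) * Complex.exp (t * Complex.I))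
  rw [hn] at h
  rw [polarNorm, hn, hk.apply_eq_of_exp_eq (mul_left_cancel₀ (by exact_mod_cast hr.ne') h)]

theorem polarNorm_polarCurve (hk : IsPolarGauge k) (t : ℝ) :
    polarNorm k (polarCurve k t) = 1 := by
  have h := hk.polarNorm_polar (inv_nonneg.2 (hk.pos t).le) t
  rw [inv_mul_cancel₀ (hk.pos t).ne'] at h
  rw [← h, polarCurve, div_eq_inv_mul, Complex.ofReal_inv]

theorem polarCurve_arg_of_polarNorm (hk : IsPolarGauge k) {z : ℂ} (hz : polarNorm k z = 1) :
    polarCurve k z.arg = z := by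
  have h : ((k z.arg : ℝ) : ℂ) ≠ 0 := by exact_mod_cast (hk.pos _).ne'
  have h1 : (‖z‖ : ℂ) * (k z.arg : ℂ) = 1 := by exact_mod_cast hz
  rw [polarCurve, div_eq_iff h]
  linear_combination (-Complex.exp (z.arg * Complex.I)) * h1 +
    (k z.arg : ℂ) * Complex.norm_mul_exp_arg_mul_I z

theorem range_polarCurve (hk : IsPolarGauge k) :
    Set.range (polarCurve k) = {z | polarNorm k z = 1} := by
  ext z
  exact ⟨by rintro ⟨t, rfl⟩; exact hk.polarNorm_polarCurve t,
    fun h => ⟨_, hk.polarCurve_arg_of_polarNorm h⟩⟩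

/-- After rotation by `-t`, both sides are `‖z‖` times the two sides of `support` at `u = w.arg`;
equality forces `u = 0` or `z = 0`. -/
theorem polarTangent_le (hk : IsPolarGauge k) (t : ℝ) (z : ℂ) :
    polarTangent k t z ≤ polarNorm k z ∧
      (polarTangent k t z = polarNorm k z → z = ‖z‖ * Complex.exp (t * Complex.I)) := by
  set w := z * Complex.exp (-(t * Complex.I)) with hw
  have hnw : ‖w‖ = ‖z‖ := by
    rw [hw, norm_mul, ← neg_mul, ← Complex.ofReal_neg, Complex.norm_exp_ofReal_mul_I, mul_one]
  have hzw : z = w * Complex.exp (t * Complex.I) := by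
    rw [hw, mul_assoc, ← Complex.exp_add, neg_add_cancel, Complex.exp_zero, mul_one]
  have hz : z = ‖z‖ * Complex.exp ((t + w.arg : ℝ) * Complex.I) := by
    rw [← hnw, Complex.ofReal_add, add_mul, Complex.exp_add, mul_left_comm,
      Complex.norm_mul_exp_arg_mul_I, mul_comm, ← hzw]
  have hN : polarNorm k z = ‖z‖ * k (t + w.arg) := by
    conv_lhs => rw [hz]
    exact hk.polarNorm_polar (norm_nonneg z) _
  have hL : polarTangent k t z =
      ‖z‖ * (k t * Real.cos w.arg + deriv k t * Real.sin w.arg) := by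
    rw [polarTangent, ← hw, ← Complex.norm_mul_cos_arg w, ← Complex.norm_mul_sin_arg w, hnw]
    ring
  by_cases h0 : w.arg = 0
  · rw [hN, hL, h0]
    refine ⟨by simp, fun _ => ?_⟩
    conv_lhs => rw [hz, h0, add_zero]
  · have hlt := hk.support t w.arg (Complex.abs_arg_le_pi w) h0
    rw [hN, hL]
    refine ⟨mul_le_mul_of_nonneg_left hlt.le (norm_nonneg z), fun h => ?_⟩
    by_cases hz0 : ‖z‖ = 0
    · rw [norm_eq_zero] at hz0
      simp [hz0]
    · exact absurd (mul_left_cancel₀ hz0 h) hlt.ne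

theorem polarNorm_add_le (hk : IsPolarGauge k) (z w : ℂ) :
    polarNorm k (z + w) ≤ polarNorm k z + polarNorm k w := by
  rw [← polarTangent_arg k (z + w), polarTangent_add]
  exact add_le_add (hk.polarTangent_le _ z).1 (hk.polarTangent_le _ w).1

theorem polarNorm_neg (hk : IsPolarGauge k) (z : ℂ) : polarNorm k (-z) = polarNorm k z := by
  have h : -z = ‖z‖ * Complex.exp ((z.arg + Real.pi : ℝ) * Complex.I) := by
    rw [Complex.ofReal_add, add_mul, Complex.exp_add, Complex.exp_pi_mul_I, mul_neg_one, mul_neg,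
      Complex.norm_mul_exp_arg_mul_I]
  rw [h, hk.polarNorm_polar (norm_nonneg z), hk.periodic, polarNorm]

theorem polarNorm_real_mul (hk : IsPolarGauge k) (a : ℝ) (z : ℂ) :
    polarNorm k (a * z) = |a| * polarNorm k z := by
  have key : ∀ b : ℝ, 0 ≤ b → polarNorm k (b * z) = b * polarNorm k z := fun b hb => by
    have h : (b : ℂ) * z = (b * ‖z‖ : ℝ) * Complex.exp (z.arg * Complex.I) := by
      rw [Complex.ofReal_mul, mul_assoc, Complex.norm_mul_exp_arg_mul_I]
    rw [h, hk.polarNorm_polar (mul_nonneg hb (norm_nonneg z)), polarNorm, mul_assoc]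
  rcases le_total 0 a with ha | ha
  · rw [key a ha, abs_of_nonneg ha]
  · rw [abs_of_nonpos ha, ← key (-a) (neg_nonneg.2 ha), ← hk.polarNorm_neg]
    simp

/-- The tangent functional in the direction of the combination computes its norm. A value of at
least 1 forces the functional to be 1 at both points, so both are the curve point on one ray. -/
theorem polarNorm_combo_lt (hk : IsPolarGauge k) {z w : ℂ} (hz : polarNorm k z ≤ 1)
    (hw : polarNorm k w ≤ 1) {a b : ℝ} (ha : 0 < a) (hb : 0 < b) (hab : a + b = 1)
    (h : z ≠ w ∨ polarNorm k z < 1) : polarNorm k (a * z + b * w) < 1 := by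
  set t := ((a : ℂ) * z + b * w).arg with ht
  have hz' := hk.polarTangent_le t z
  have hw' := hk.polarTangent_le t w
  rw [← polarTangent_arg, ← ht, polarTangent_add, polarTangent_real_mul, polarTangent_real_mul]
  by_contra! hge
  have h1 : polarTangent k t z = 1 := by
    by_contra hne
    have : polarTangent k t z < 1 := lt_of_le_of_ne (hz'.1.trans hz) hne
    nlinarith [hw'.1]
  have h2 : polarTangent k t w = 1 := by
    by_contra hne
    have : polarTangent k t w < 1 := lt_of_le_of_ne (hw'.1.trans hw) hne
    nlinarith [hz'.1]
  have h3 : polarNorm k z = 1 := le_antisymm hz (h1 ▸ hz'.1)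
  have h4 : polarNorm k w = 1 := le_antisymm hw (h2 ▸ hw'.1)
  have ez := hz'.2 (h1.trans h3.symm)
  have ew := hw'.2 (h2.trans h4.symm)
  rcases h with h | h
  · apply h
    rw [ez, hk.polarNorm_polar (norm_nonneg z)] at h3
    rw [ew, hk.polarNorm_polar (norm_nonneg w)] at h4
    rw [ez, ew, mul_right_cancel₀ (hk.pos t).ne' (h3.trans h4.symm)]
  · exact h.ne h3

/-- `polarNorm k` as a seminorm on the real vector space `ℂ`. -/
noncomputable def polarSeminorm (hk : IsPolarGauge k) : Seminorm ℝ ℂ :=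
  Seminorm.of (polarNorm k) hk.polarNorm_add_le fun a z => by
    rw [Complex.real_smul, hk.polarNorm_real_mul, Real.norm_eq_abs]

theorem exists_le_le (hk : IsPolarGauge k) : ∃ m M : ℝ, 0 < m ∧ ∀ t, m ≤ k t ∧ k t ≤ M := by
  have hc := hk.periodic.compact_of_continuous Real.pi_ne_zero hk.contDiff.continuous
  obtain ⟨_, ⟨s, rfl⟩, hs⟩ := hc.exists_isLeast (Set.range_nonempty k)
  obtain ⟨_, ⟨t, rfl⟩, ht⟩ := hc.exists_isGreatest (Set.range_nonempty k)
  exact ⟨k s, k t, hk.pos s, fun u => ⟨hs ⟨u, rfl⟩, ht ⟨u, rfl⟩⟩⟩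

theorem continuous_polarNorm (hk : IsPolarGauge k) : Continuous (polarNorm k) := by
  obtain ⟨m, M, hm, h⟩ := hk.exists_le_le
  have hM : 0 ≤ M := hm.le.trans ((h 0).1.trans (h 0).2)
  have : Continuous hk.polarSeminorm := by
    refine Seminorm.continuous_of_le (q := M.toNNReal • normSeminorm ℝ ℂ) ?_ fun z => ?_
    · exact continuous_norm.const_smul M.toNNReal
    · change ‖z‖ * k z.arg ≤ (M.toNNReal : ℝ) * ‖z‖
      rw [mul_comm, Real.coe_toNNReal M hM]
      exact mul_le_mul_of_nonneg_right (h _).2 (norm_nonneg z)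
  exact this

/-! ### Convexity, simplicity and smoothness of the curve -/

theorem isConvexCurve_polarCurve (hk : IsPolarGauge k) :
    IsConvexCurve (Set.range (polarCurve k)) := by
  have hopen : IsOpen {z | polarNorm k z < 1} := isOpen_lt hk.continuous_polarNorm continuous_const
  refine ⟨{z | polarNorm k z < 1}, ⟨0, by simp [polarNorm]⟩, hopen, ?_, ?_, ?_⟩
  · obtain ⟨m, M, hm, h⟩ := hk.exists_le_le
    refine (Metric.isBounded_closedBall (x := (0 : ℂ)) (r := 1 / m)).subset fun z hz => ?_
    rw [mem_closedBall_zero_iff, le_div_iff₀ hm]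
    exact (mul_le_mul_of_nonneg_left (h _).1 (norm_nonneg z)).trans (le_of_lt hz)
  · have := hk.polarSeminorm.convex_ball 0 1
    rwa [Seminorm.ball_zero_eq] at this
  · rw [hk.range_polarCurve]
    refine (frontier_lt_subset_eq hk.continuous_polarNorm continuous_const).antisymm fun z hz => ?_
    have hz : polarNorm k z = 1 := hz
    rw [hopen.frontier_eq]
    refine ⟨?_, fun h => h.ne hz⟩
    -- A point of the curve is the limit of its radial contractions, which lie inside.
    have ht : Filter.Tendsto (fun a : ℝ => (a : ℂ) * z) (nhdsWithin 1 (Set.Ioo 0 1))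
        (nhds z) := by
      have : Continuous fun a : ℝ => (a : ℂ) * z := by fun_prop
      simpa using (this.tendsto 1).mono_left nhdsWithin_le_nhds
    have : (nhdsWithin (1 : ℝ) (Set.Ioo 0 1)).NeBot := right_nhdsWithin_Ioo_neBot zero_lt_one
    refine mem_closure_of_tendsto ht ?_
    filter_upwards [self_mem_nhdsWithin] with a ha
    rw [hk.polarNorm_real_mul, hz, mul_one, abs_of_pos ha.1]
    exact ha.2

theorem isSimpleClosedCurve_polarCurve (hk : IsPolarGauge k) :
    IsSimpleClosedCurve (polarCurve k) where
  continuous := by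
    refine Continuous.div (by fun_prop) ?_ fun t => by exact_mod_cast (hk.pos t).ne'
    exact Complex.continuous_ofReal.comp hk.contDiff.continuous
  periodic t := by
    rw [polarCurve, hk.periodic_two_pi t, polarCurve]
    congr 1
    rw [Complex.ofReal_add, add_mul, Complex.exp_add]
    simp [Complex.exp_two_pi_mul_I]
  injOn s hs t ht h := by
    have hn : ∀ u, ‖polarCurve k u‖ = (k u)⁻¹ := fun u => by
      rw [polarCurve, norm_div, Complex.norm_exp_ofReal_mul_I, Complex.norm_of_nonneg (hk.pos u).le,
        one_div]
    have h1 : k s = k t := by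
      have := congrArg norm h
      rwa [hn, hn, inv_inj] at this
    have h2 : Complex.exp (s * Complex.I) = Complex.exp (t * Complex.I) := by
      rw [polarCurve, polarCurve, h1] at h
      exact (div_left_inj' (by exact_mod_cast (hk.pos t).ne')).1 h
    obtain ⟨m, hm⟩ := Complex.exp_eq_exp_iff_exists_int.1 h2
    have h3 : s = t + m * (2 * Real.pi) := by
      have := congrArg Complex.im hm
      simpa using this
    have hp := Real.two_pi_pos
    have hm1 : (m : ℝ) < 1 := by
      by_contra! hc
      nlinarith [hs.2, ht.1]
    have hm2 : (-1 : ℝ) < m := by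
      by_contra! hc
      nlinarith [hs.1, ht.2]
    have hm0 : m = 0 := by
      have : m < 1 := by exact_mod_cast hm1
      have : -1 < m := by exact_mod_cast hm2
      omega
    rw [h3, hm0]
    simp

theorem isSmoothCurve_polarCurve (hk : IsPolarGauge k) : IsSmoothCurve (polarCurve k) where
  contDiff := by
    have h : ContDiff ℝ ∞ fun t : ℝ => Complex.exp (t * Complex.I) * ((k t)⁻¹ : ℝ) :=
      (Complex.ofRealCLM.contDiff.mul contDiff_const).cexp.mul
        (Complex.ofRealCLM.contDiff.comp (hk.contDiff.inv fun t => (hk.pos t).ne'))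
    convert h using 2 with t
    rw [polarCurve, Complex.ofReal_inv, div_eq_mul_inv]
  deriv_ne_zero t := by
    have hd : HasDerivAt k (deriv k t) t :=
      (hk.contDiff.differentiable (by simp) t).hasDerivAt
    have he : HasDerivAt (fun s : ℝ => Complex.exp (s * Complex.I))
        (Complex.exp (t * Complex.I) * (1 * Complex.I)) t :=
      ((Complex.ofRealCLM.hasDerivAt (x := t)).mul_const Complex.I).cexp
    have hne : ((k t : ℝ) : ℂ) ≠ 0 := by exact_mod_cast (hk.pos t).ne'
    have h := he.div hd.ofReal_comp hne
    rw [show polarCurve k = fun s : ℝ => Complex.exp (s * Complex.I) / (k s : ℂ) from rfl]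
    erw [h.deriv]
    refine div_ne_zero ?_ (pow_ne_zero 2 hne)
    -- The numerator is `exp (I t) * (I k - k')`, whose second factor has imaginary part `k t > 0`.
    rw [one_mul, mul_assoc, ← mul_sub]
    refine mul_ne_zero (Complex.exp_ne_zero _) fun h0 => (hk.pos t).ne' ?_
    simpa using congrArg Complex.im h0

/-! ### Parallel chords and the centre of an inscribed square -/

/-- The chords `p ± c` and `-p ± c` span a parallelogram. A chord `q ± c` strictly between their
lines, or slid along, would have the endpoint `q - c` in the open region. -/
theorem parallel_chord_coeff (hk : IsPolarGauge k) {c p q : ℂ} {s τ : ℝ} (hc : c ≠ 0) (hp : p ≠ 0)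
    (h₁ : polarNorm k (p + c) = 1) (h₂ : polarNorm k (p - c) = 1)
    (h₃ : polarNorm k (q + c) = 1) (h₄ : polarNorm k (q - c) = 1)
    (hs₀ : 0 ≤ s) (hs₁ : s ≤ 1) (hτ : 0 ≤ τ) (hq : q = s * p + τ * c) : q = p := by
  have hlt : s < 1 → polarNorm k (s * p - c) < 1 := fun hs => by
    -- `s * p - c` divides the segment from `p - c` to `-(p + c)`.
    have h := hk.polarNorm_combo_lt h₂.le ((hk.polarNorm_neg (p + c)).trans h₁).le
      (a := (1 + s) / 2) (b := (1 - s) / 2) (by linarith) (by linarith) (by ring)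
      (Or.inl fun h => hp (by linear_combination h / 2))
    convert h using 2
    push_cast
    ring
  have hle : polarNorm k (s * p - c) ≤ 1 := by
    rcases hs₁.eq_or_lt with rfl | hs
    · simpa using h₂.le
    · exact (hlt hs).le
  rcases hτ.eq_or_lt with rfl | hτ
  · rcases hs₁.eq_or_lt with rfl | hs
    · simpa using hq
    · have := hlt hs
      rw [hq] at h₄
      simp only [Complex.ofReal_zero, zero_mul, add_zero] at h₄
      exact absurd h₄ this.ne
  · have hτ2 : (τ : ℂ) + 2 ≠ 0 := by exact_mod_cast (by linarith : (0 : ℝ) < τ + 2).ne'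
    -- `q - c` lies strictly between `s * p - c` and `q + c`, at distances `τ` and `2` in units of
    -- `c`.
    have h := hk.polarNorm_combo_lt hle h₃.le (a := 2 / (τ + 2)) (b := τ / (τ + 2))
      (by positivity) (by positivity) (by field_simp; ring)
      (Or.inl fun h => mul_ne_zero hτ2 hc (by rw [hq] at h; linear_combination -h))
    refine absurd h₄ (ne_of_lt (lt_of_eq_of_lt (congrArg _ ?_) h))
    rw [hq]
    push_cast
    field_simp
    ring

theorem eq_or_eq_neg_of_parallel_chords (hk : IsPolarGauge k) {c p q : ℂ} (hc : c ≠ 0)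
    (h₁ : polarNorm k (p + c) = 1) (h₂ : polarNorm k (p - c) = 1)
    (h₃ : polarNorm k (q + c) = 1) (h₄ : polarNorm k (q - c) = 1)
    (h0 : p.re * c.im - p.im * c.re ≠ 0)
    (hle : |q.re * c.im - q.im * c.re| ≤ |p.re * c.im - p.im * c.re|) : q = p ∨ q = -p := by
  have hp : p ≠ 0 := by
    rintro rfl
    simp at h0
  set D := p.re * c.im - p.im * c.re
  obtain ⟨s, τ, hs, hq⟩ : ∃ s τ : ℝ, |s| ≤ 1 ∧ q = s * p + τ * c := by
    -- Cramer's rule in the basis `p`, `c`.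
    refine ⟨(q.re * c.im - q.im * c.re) / D, (p.re * q.im - p.im * q.re) / D, ?_, ?_⟩
    · rw [abs_div]
      exact div_le_one_of_le₀ hle (abs_nonneg _)
    · apply Complex.ext
      · simp only [Complex.add_re, Complex.re_ofReal_mul]
        field_simp
        ring
      · simp only [Complex.add_im, Complex.im_ofReal_mul]
        field_simp
        ring
  have n₁ : polarNorm k (-p + c) = 1 := by rw [← h₂, ← hk.polarNorm_neg]; congr 1; ring
  have n₂ : polarNorm k (-p - c) = 1 := by rw [← h₁, ← hk.polarNorm_neg]; congr 1; ring
  obtain ⟨hs₁, hs₂⟩ := abs_le.1 hs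
  -- The signs of `s` and `τ` are absorbed by replacing `p` with `-p` and `c` with `-c`.
  rcases le_total 0 s with hs0 | hs0 <;> rcases le_total 0 τ with hτ | hτ
  · exact Or.inl (hk.parallel_chord_coeff hc hp h₁ h₂ h₃ h₄ hs0 hs₂ hτ hq)
  · refine Or.inl (hk.parallel_chord_coeff (neg_ne_zero.2 hc) hp (s := s) (τ := -τ)
      ?_ ?_ ?_ ?_ hs0 hs₂ (by linarith) (by rw [hq]; push_cast; ring))
    · rwa [← sub_eq_add_neg]
    · rwa [sub_neg_eq_add]
    · rwa [← sub_eq_add_neg]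
    · rwa [sub_neg_eq_add]
  · exact Or.inr (hk.parallel_chord_coeff hc (neg_ne_zero.2 hp) n₁ n₂ h₃ h₄ (s := -s) (τ := τ)
      (by linarith) (by linarith) hτ (by rw [hq]; push_cast; ring))
  · refine Or.inr (hk.parallel_chord_coeff (neg_ne_zero.2 hc) (neg_ne_zero.2 hp) (s := -s)
      (τ := -τ) ?_ ?_ ?_ ?_ (by linarith) (by linarith) (by linarith) (by rw [hq]; push_cast; ring))
    · rwa [← sub_eq_add_neg]
    · rwa [sub_neg_eq_add]
    · rwa [← sub_eq_add_neg]
    · rwa [sub_neg_eq_add]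

/-- Squares inscribed in the curve `r = 1 / k θ` are centred at the origin. -/
theorem square_center_eq_zero (hk : IsPolarGauge k) {c p : ℂ} (hp : p ≠ 0)
    (h₁ : polarNorm k (c + p) = 1) (h₂ : polarNorm k (c - p) = 1)
    (h₃ : polarNorm k (c + Complex.I * p) = 1) (h₄ : polarNorm k (c - Complex.I * p) = 1) :
    c = 0 := by
  by_contra hc
  rw [add_comm] at h₁ h₃
  rw [← neg_sub, hk.polarNorm_neg] at h₂ h₄
  have hI : Complex.I * p ≠ p := fun h => by
    have h' := mul_right_cancel₀ hp (h.trans (one_mul p).symm)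
    simpa using congrArg Complex.re h'
  have hI' : Complex.I * p ≠ -p := fun h => by
    have h' := mul_right_cancel₀ hp (h.trans (neg_one_mul p).symm)
    simpa using congrArg Complex.re h'
  -- The chord farther from the origin serves as reference. If its determinant vanishes, `p` and `I
  -- * p` are both parallel to `c`, so `p = 0`.
  rcases le_total |(Complex.I * p).re * c.im - (Complex.I * p).im * c.re|
    |p.re * c.im - p.im * c.re| with hle | hle
  · by_cases h0 : p.re * c.im - p.im * c.re = 0
    · rw [h0, abs_zero, abs_nonpos_iff] at hle
      simp only [Complex.I_mul_re, Complex.I_mul_im] at hle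
      have hc2 : c.re * c.re + c.im * c.im ≠ 0 := by
        rw [← Complex.normSq_apply]
        exact (Complex.normSq_pos.2 hc).ne'
      refine hp (Complex.ext ?_ ?_)
      · refine (mul_eq_zero.1 ?_).resolve_right hc2
        linear_combination c.im * h0 - c.re * hle
      · refine (mul_eq_zero.1 ?_).resolve_right hc2
        linear_combination -c.re * h0 - c.im * hle
    · rcases hk.eq_or_eq_neg_of_parallel_chords hc h₁ h₂ h₃ h₄ h0 hle with h | h
      exacts [hI h, hI' h]
  · by_cases h0 : (Complex.I * p).re * c.im - (Complex.I * p).im * c.re = 0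
    · rw [h0, abs_zero, abs_nonpos_iff] at hle
      simp only [Complex.I_mul_re, Complex.I_mul_im] at h0
      have hc2 : c.re * c.re + c.im * c.im ≠ 0 := by
        rw [← Complex.normSq_apply]
        exact (Complex.normSq_pos.2 hc).ne'
      refine hp (Complex.ext ?_ ?_)
      · refine (mul_eq_zero.1 ?_).resolve_right hc2
        linear_combination c.im * hle - c.re * h0
      · refine (mul_eq_zero.1 ?_).resolve_right hc2
        linear_combination -c.re * hle - c.im * h0
    · rcases hk.eq_or_eq_neg_of_parallel_chords hc h₃ h₄ h₁ h₂ h0 hle with h | h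
      · exact hI h.symm
      · exact hI' (eq_neg_iff_add_eq_zero.2 (by linear_combination h))

end IsPolarGauge

/-! ### Small perturbations of the circle -/

theorem abs_le_mul_sq_of_abs_deriv2_le {f f' f'' : ℝ → ℝ} {C : ℝ}
    (hf : ∀ x, HasDerivAt f (f' x) x) (hf' : ∀ x, HasDerivAt f' (f'' x) x)
    (h0 : f 0 = 0) (h0' : f' 0 = 0) (hC : ∀ x, |f'' x| ≤ C) (u : ℝ) : |f u| ≤ C * u ^ 2 := by
  have hC0 : 0 ≤ C := (abs_nonneg _).trans (hC 0)
  have h1 : ∀ x, |f' x| ≤ C * |x| := fun x => by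
    have := convex_univ.norm_image_sub_le_of_norm_hasDerivWithin_le
      (fun x _ => (hf' x).hasDerivWithinAt) (fun x _ => hC x) (Set.mem_univ 0) (Set.mem_univ x)
    simpa [h0'] using this
  have h2 := (convex_closedBall (0 : ℝ) |u|).norm_image_sub_le_of_norm_hasDerivWithin_le
    (x := 0) (y := u) (C := C * |u|)
    (fun x _ => (hf x).hasDerivWithinAt)
    (fun x hx => (h1 x).trans (mul_le_mul_of_nonneg_left (by simpa using hx) hC0))
    (by simp) (by simp)
  simp only [h0, sub_zero, Real.norm_eq_abs] at h2
  rwa [mul_assoc, abs_mul_abs_self, ← sq] at h2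

theorem Function.Periodic.exists_abs_le {f : ℝ → ℝ} {c : ℝ} (hp : Function.Periodic f c)
    (hc : c ≠ 0) (hf : Continuous f) : ∃ M, ∀ t, |f t| ≤ M := by
  obtain ⟨M, hM⟩ := (hp.compact_of_continuous hc hf).isBounded.exists_norm_le
  exact ⟨M, fun t => hM _ ⟨t, rfl⟩⟩

theorem Function.Periodic.deriv_periodic {f : ℝ → ℝ} {c : ℝ} (hp : Function.Periodic f c) :
    Function.Periodic (deriv f) c := fun t => by
  rw [← deriv_comp_add_const, show (fun x => f (x + c)) = f from funext hp]

/-- Small smooth perturbations of the circle are strictly convex. -/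
theorem exists_isPolarGauge_one_add_mul {h : ℝ → ℝ} (hh : ContDiff ℝ ∞ h)
    (hp : Function.Periodic h Real.pi) :
    ∃ ε : ℝ, 0 < ε ∧ IsPolarGauge fun t => 1 + ε * h t := by
  have hd : ContDiff ℝ ∞ (deriv h) := ((contDiff_infty_iff_deriv (𝕜 := ℝ)).1 hh).2
  have hdd : ContDiff ℝ ∞ (deriv (deriv h)) := ((contDiff_infty_iff_deriv (𝕜 := ℝ)).1 hd).2
  have h1 : ∀ t, HasDerivAt h (deriv h t) t := fun t =>
    (hh.differentiable (by simp) t).hasDerivAt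
  have h2 : ∀ t, HasDerivAt (deriv h) (deriv (deriv h) t) t := fun t =>
    (hd.differentiable (by simp) t).hasDerivAt
  obtain ⟨M₀, hM₀⟩ := hp.exists_abs_le Real.pi_ne_zero hh.continuous
  obtain ⟨M₁, hM₁⟩ := hp.deriv_periodic.exists_abs_le Real.pi_ne_zero hd.continuous
  obtain ⟨M₂, hM₂⟩ := hp.deriv_periodic.deriv_periodic.exists_abs_le Real.pi_ne_zero hdd.continuous
  have p₀ := (abs_nonneg _).trans (hM₀ 0)
  have p₁ := (abs_nonneg _).trans (hM₁ 0)
  have p₂ := (abs_nonneg _).trans (hM₂ 0)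
  set C := M₀ + M₁ + M₂ with hCdef
  have hC : 0 ≤ C := by positivity
  -- The difference vanishes to second order at `u = 0`, and its second derivative is bounded by
  -- `C`.
  have key : ∀ t u, |h (t + u) - h t * Real.cos u - deriv h t * Real.sin u| ≤ C * u ^ 2 := by
    intro t
    refine abs_le_mul_sq_of_abs_deriv2_le
      (f := fun u => h (t + u) - h t * Real.cos u - deriv h t * Real.sin u)
      (f' := fun u => deriv h (t + u) - h t * (-Real.sin u) - deriv h t * Real.cos u)
      (f'' := fun u => deriv (deriv h) (t + u) - h t * (-Real.cos u) - deriv h t * (-Real.sin u))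
      (fun u => ?_) (fun u => ?_) (by simp) (by simp) fun u => ?_
    · exact (((h1 (t + u)).comp_const_add t u).sub ((Real.hasDerivAt_cos u).const_mul _)).sub
        ((Real.hasDerivAt_sin u).const_mul _)
    · exact (((h2 (t + u)).comp_const_add t u).sub ((Real.hasDerivAt_sin u).neg.const_mul _)).sub
        ((Real.hasDerivAt_cos u).const_mul _)
    · have e₀ : |h t * Real.cos u| ≤ M₀ := by
        rw [abs_mul]
        exact (mul_le_of_le_one_right (abs_nonneg _) (Real.abs_cos_le_one u)).trans (hM₀ t)
      have e₁ : |deriv h t * Real.sin u| ≤ M₁ := by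
        rw [abs_mul]
        exact (mul_le_of_le_one_right (abs_nonneg _) (Real.abs_sin_le_one u)).trans (hM₁ t)
      have e₂ := hM₂ (t + u)
      rw [abs_le] at *
      constructor <;> linarith [e₀.1, e₀.2, e₁.1, e₁.2, e₂.1, e₂.2]
  have hπ := Real.pi_pos
  -- Chosen so that the error `ε * C * u ^ 2` is below the gap `1 - cos u ≥ 2 / π ^ 2 * u ^ 2` on
  -- `[-π, π]`.
  set ε := 1 / (Real.pi ^ 2 * (C + 1)) with hε
  have hεpos : 0 < ε := by positivity
  have hεC : ε * (C + 1) = 1 / Real.pi ^ 2 := by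
    rw [hε]
    field_simp
  have hlt : 0 < 2 / Real.pi ^ 2 - ε * C := by
    have h3 : 2 / Real.pi ^ 2 = 2 * (ε * (C + 1)) := by rw [hεC]; ring
    nlinarith
  refine ⟨ε, hεpos, contDiff_const.add (contDiff_const.mul hh), fun t => by simp only [hp t],
    fun t => ?_, fun t u hu hu0 => ?_⟩
  · have hεM : ε * M₀ < 1 := by
      have h3 : 1 / Real.pi ^ 2 ≤ 1 := by
        rw [div_le_one (by positivity)]
        nlinarith [Real.pi_gt_three]
      nlinarith
    nlinarith [(abs_le.1 (hM₀ t)).1]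
  · have hder : deriv (fun t => 1 + ε * h t) t = ε * deriv h t :=
      (((h1 t).const_mul ε).const_add 1).deriv
    rw [hder]
    have hcos := Real.cos_le_one_sub_mul_cos_sq hu
    have hk := mul_le_mul_of_nonneg_left (abs_le.1 (key t u)).1 hεpos.le
    have hu2 : 0 < u ^ 2 := by positivity
    nlinarith [mul_pos hlt hu2]

/-! ### The profile and the count of squares -/

/-- A function with `n` zeros modulo `π / 2` that changes sign under translation by `π / 2`. -/
noncomputable def squareProfile (n : ℕ) (t : ℝ) : ℝ :=
  Real.sin (2 * t) * Real.sin (n * (2 * t)) ^ 2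

theorem contDiff_squareProfile (n : ℕ) : ContDiff ℝ ∞ (squareProfile n) := by
  unfold squareProfile
  fun_prop

theorem squareProfile_add_pi_div_two (n : ℕ) (t : ℝ) :
    squareProfile n (t + Real.pi / 2) = -squareProfile n t := by
  have h1 : 2 * (t + Real.pi / 2) = 2 * t + Real.pi := by ring
  have h2 : (n : ℝ) * (2 * t + Real.pi) = n * (2 * t) + n * Real.pi := by ring
  rw [squareProfile, squareProfile, h1, h2, Real.sin_add_pi, Real.sin_add_nat_mul_pi, mul_pow,
    ← pow_mul, mul_comm n 2, pow_mul]
  simp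

theorem periodic_squareProfile (n : ℕ) : Function.Periodic (squareProfile n) Real.pi := fun t => by
  rw [← neg_neg (squareProfile n t), ← squareProfile_add_pi_div_two,
    ← squareProfile_add_pi_div_two]
  congr 1
  ring

theorem squareProfile_eq_zero_iff (n : ℕ) (t : ℝ) :
    squareProfile n t = 0 ↔ Complex.exp (t * Complex.I) ^ (4 * n) = 1 := by
  have h1 : squareProfile n t = 0 ↔ Real.sin (n * (2 * t)) = 0 := by
    -- The factor `sin (2 * t)` adds no zeros: they are already zeros of `sin (n * (2 * t))`.
    rw [squareProfile, mul_eq_zero, sq_eq_zero_iff, or_iff_right_iff_imp]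
    intro h
    obtain ⟨m, hm⟩ := Real.sin_eq_zero_iff.1 h
    rw [← hm, ← mul_assoc]
    exact_mod_cast Real.sin_int_mul_pi (n * m)
  have h2 : Complex.exp (t * Complex.I) ^ (4 * n) =
      Complex.exp ((2 * (n * (2 * t)) : ℝ) * Complex.I) := by
    rw [← Complex.exp_nat_mul]
    congr 1
    push_cast
    ring
  rw [h1, h2]
  constructor
  · intro h
    obtain ⟨m, hm⟩ := Real.sin_eq_zero_iff.1 h
    rw [Complex.exp_eq_one_iff]
    refine ⟨m, ?_⟩
    rw [← hm]
    push_cast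
    ring
  · intro h
    have := congrArg Complex.re h
    rw [Complex.exp_ofReal_mul_I_re, Real.cos_two_mul, Complex.one_re] at this
    nlinarith [Real.sin_sq_add_cos_sq (n * (2 * t))]

theorem setOf_pow_four_eq (p : ℂ) :
    {x : ℂ | x ^ 4 = p ^ 4} = {p, Complex.I * p, -p, -(Complex.I * p)} := by
  ext x
  have h : x ^ 4 - p ^ 4 =
      (x - p) * ((x - Complex.I * p) * ((x + p) * (x + Complex.I * p))) := by
    linear_combination (p ^ 2 * (x ^ 2 - p ^ 2)) * Complex.I_sq
  simp only [Set.mem_ofPred_eq, Set.mem_insert_iff, Set.mem_singleton_iff]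
  rw [← sub_eq_zero, h, mul_eq_zero, mul_eq_zero, mul_eq_zero, sub_eq_zero, sub_eq_zero,
    add_eq_zero_iff_eq_neg, add_eq_zero_iff_eq_neg]

theorem isSquareVertexSet_setOf_pow_four_eq {p : ℂ} (hp : p ≠ 0) :
    IsSquareVertexSet {x : ℂ | x ^ 4 = p ^ 4} := by
  refine ⟨p, (Complex.I - 1) * p, mul_ne_zero (fun h => ?_) hp, ?_⟩
  · simpa using congrArg Complex.im h
  · rw [setOf_pow_four_eq]
    congr 1
    have h1 : p + (Complex.I - 1) * p = Complex.I * p := by ring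
    have h2 : Complex.I * p + Complex.I * ((Complex.I - 1) * p) = -p := by
      linear_combination p * Complex.I_sq
    have h3 : p + Complex.I * ((Complex.I - 1) * p) = -(Complex.I * p) := by
      linear_combination p * Complex.I_sq
    rw [h1, h2, h3]

theorem inscribedSquares_polarCurve {n : ℕ} (hn : 0 < n) {ε : ℝ} (hε : 0 < ε)
    (hk : IsPolarGauge fun t => 1 + ε * squareProfile n t) :
    inscribedSquares (Set.range (polarCurve fun t => 1 + ε * squareProfile n t)) =
      (fun w : ℂ => {x | x ^ 4 = w}) '' {w | w ^ n = 1} := by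
  rw [hk.range_polarCurve]
  ext S
  constructor
  · rintro ⟨⟨z, v, hv, rfl⟩, hS⟩
    -- `c` is the centre and `p` the half-diagonal from it to `z`.
    set c := z + (1 + Complex.I) / 2 * v with hc
    set p := -((1 + Complex.I) / 2 * v) with hp
    have hp0 : p ≠ 0 := by
      refine neg_ne_zero.2 (mul_ne_zero (fun h => ?_) hv)
      simpa using congrArg Complex.re h
    have e₁ : z = c + p := by rw [hc, hp]; ring
    have e₂ : z + v = c + Complex.I * p := by
      rw [hc, hp]; linear_combination v / 2 * Complex.I_sq
    have e₃ : z + v + Complex.I * v = c - p := by rw [hc, hp]; ring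
    have e₄ : z + Complex.I * v = c - Complex.I * p := by
      rw [hc, hp]; linear_combination -v / 2 * Complex.I_sq
    rw [e₃, e₂, e₄] at hS ⊢
    rw [e₁] at hS ⊢
    clear_value c p
    have h₁ := hS (show c + p ∈ _ by simp)
    have h₂ := hS (show c - p ∈ _ by simp)
    have h₃ := hS (show c + Complex.I * p ∈ _ by simp)
    have h₄ := hS (show c - Complex.I * p ∈ _ by simp)
    have h0 := hk.square_center_eq_zero hp0 h₁ h₂ h₃ h₄
    subst h0
    simp only [zero_add, zero_sub] at h₁ h₃ ⊢
    have hpol := Complex.norm_mul_exp_arg_mul_I p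
    have hIpol : Complex.I * p = ‖p‖ * Complex.exp ((p.arg + Real.pi / 2 : ℝ) * Complex.I) := by
      rw [Complex.ofReal_add, add_mul, Complex.exp_add, ← mul_assoc, hpol, Complex.ofReal_div,
        Complex.ofReal_ofNat, Complex.exp_pi_div_two_mul_I, mul_comm]
    have h₁ : ‖p‖ * (1 + ε * squareProfile n p.arg) = 1 := h₁
    rw [hIpol, Set.mem_ofPred_eq, hk.polarNorm_polar (norm_nonneg p),
      squareProfile_add_pi_div_two] at h₃
    -- The adjacent vertices `p` and `I * p` give `1 + ε h = 1 - ε h`.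
    have hz : squareProfile n p.arg = 0 := by
      have h5 := mul_left_cancel₀ (norm_ne_zero_iff.2 hp0) (h₁.trans h₃.symm)
      have : ε * squareProfile n p.arg = 0 := by linarith
      exact (mul_eq_zero.1 this).resolve_left hε.ne'
    rw [hz, mul_zero, add_zero, mul_one] at h₁
    refine ⟨p ^ 4, ?_, setOf_pow_four_eq p⟩
    rw [Set.mem_ofPred_eq, ← pow_mul, ← hpol, h₁, Complex.ofReal_one, one_mul]
    exact (squareProfile_eq_zero_iff n _).1 hz
  · rintro ⟨w, hw, rfl⟩
    have hw : w ^ n = 1 := hw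
    obtain ⟨p, rfl⟩ := IsAlgClosed.exists_pow_nat_eq w (n := 4) (by norm_num)
    have hp0 : p ≠ 0 := by
      rintro rfl
      simp [hn.ne'] at hw
    refine ⟨isSquareVertexSet_setOf_pow_four_eq hp0, fun x hx => ?_⟩
    have hx : x ^ (4 * n) = 1 := by
      rw [pow_mul, show x ^ 4 = p ^ 4 from hx, hw]
    have hx1 : ‖x‖ = 1 := Complex.norm_eq_one_of_pow_eq_one hx (by omega)
    have hpol := Complex.norm_mul_exp_arg_mul_I x
    rw [hx1, Complex.ofReal_one, one_mul] at hpol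
    have hz : squareProfile n x.arg = 0 := by
      rw [squareProfile_eq_zero_iff, hpol, hx]
    rw [Set.mem_ofPred_eq, polarNorm, hx1, hz]
    simp

theorem encard_setOf_pow_eq_one {n : ℕ} (hn : 0 < n) : {w : ℂ | w ^ n = 1}.encard = n := by
  have h : {w : ℂ | w ^ n = 1} = (Polynomial.nthRootsFinset n (1 : ℂ) : Set ℂ) := by
    ext w
    simp [Polynomial.mem_nthRootsFinset hn]
  rw [h, Set.encard_coe_eq_coe_finsetCard,
    (Complex.isPrimitiveRoot_exp n hn.ne').card_nthRootsFinset]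

theorem injective_setOf_pow_four_eq :
    Function.Injective fun w : ℂ => {x : ℂ | x ^ 4 = w} := fun w w' h => by
  obtain ⟨p, rfl⟩ := IsAlgClosed.exists_pow_nat_eq w (n := 4) (by norm_num)
  exact (Set.ext_iff.1 h p).1 rfl

theorem theorem1 (n : ℕ) (hn : 0 < n) :
    ∃ γ : ℝ → ℂ, IsSimpleClosedCurve γ ∧ IsSmoothCurve γ ∧ IsConvexCurve (Set.range γ) ∧
      (inscribedSquares (Set.range γ)).encard = n := by
  obtain ⟨ε, hε, hk⟩ :=
    exists_isPolarGauge_one_add_mul (contDiff_squareProfile n) (periodic_squareProfile n)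
  refine ⟨_, hk.isSimpleClosedCurve_polarCurve, hk.isSmoothCurve_polarCurve,
    hk.isConvexCurve_polarCurve, ?_⟩
  rw [inscribedSquares_polarCurve hn hε hk, injective_setOf_pow_four_eq.encard_image,
    encard_setOf_pow_eq_one hn]
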